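/- All topological groups are Hausdorff and all topological vector spaces are real. An extension of topological abelian groups is a short exact sequence $0\to Y\xrightarrow{\imath} X\xrightarrow{\pi} Z\to 0$ of topological abelian groups in which $\imath$ and $\pi$ are continuous homomorphisms that are open onto their images; it is an extension of topological vector spaces if in addition $Y,X,Z$ are topological vector spaces and $\imath,\pi$ are linear. A topological vector space is locally bounded if $0$ has a bounded neighbourhood. Let $0\to Y\xrightarrow{\imath} X\xrightarrow{\pi} Z\to 0$ be an extension of topological abelian groups, where $Y$ is a complete locally bounded topological vector space and $Z$ is a locally bounded topological vector space. Then there is a scalar multiplication $\mathbb{R}\times X\to X$ which, together with the given addition and topology of $X$, makes $X$ a locally bounded topological vector space and makes $0\to Y\xrightarrow{\imath} X\xrightarrow{\pi} Z\to 0$ (with the given vector space structures on $Y$ and $Z$) an extension of topological vector spaces. -/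

import Mathlib

open Topology

/-- A real topological vector space is locally bounded if `0` has a (von Neumann) bounded
neighbourhood, i.e. a neighbourhood absorbed by every neighbourhood of `0`. -/
def IsLocallyBoundedTVS (E : Type*) [AddCommGroup E] [TopologicalSpace E] [Module ℝ E] : Prop :=
  ∃ U ∈ 𝓝 (0 : E), Bornology.IsVonNBounded ℝ U

/-- `0 → Y → X → Z → 0` is an extension of topological abelian groups: a short exact sequence of
group homomorphisms which are continuous and open onto their images. -/
structure IsTopAddGroupExtension {Y X Z : Type*}
    [AddCommGroup Y] [TopologicalSpace Y] [IsTopologicalAddGroup Y]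
    [AddCommGroup X] [TopologicalSpace X] [IsTopologicalAddGroup X]
    [AddCommGroup Z] [TopologicalSpace Z] [IsTopologicalAddGroup Z]
    (i : Y →+ X) (p : X →+ Z) : Prop where
  injective : Function.Injective i
  exact : i.range = p.ker
  surjective : Function.Surjective p
  continuous_left : Continuous i
  continuous_right : Continuous p
  open_left : IsOpenMap (Set.rangeFactorization i)
  open_right : IsOpenMap (Set.rangeFactorization p)

/-- `0 → Y → X → Z → 0` is an extension of (real) topological vector spaces: an extension of
topological abelian groups between topological vector spaces whose maps are linear. -/
structure IsTVSExtension {Y X Z : Type*}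
    [AddCommGroup Y] [TopologicalSpace Y] [IsTopologicalAddGroup Y] [Module ℝ Y]
    [ContinuousSMul ℝ Y]
    [AddCommGroup X] [TopologicalSpace X] [IsTopologicalAddGroup X] [Module ℝ X]
    [ContinuousSMul ℝ X]
    [AddCommGroup Z] [TopologicalSpace Z] [IsTopologicalAddGroup Z] [Module ℝ Z]
    [ContinuousSMul ℝ Z]
    (i : Y →+ X) (p : X →+ Z) : Prop extends IsTopAddGroupExtension i p where
  map_smul_left : ∀ (r : ℝ) (y : Y), i (r • y) = r • i y
  map_smul_right : ∀ (r : ℝ) (x : X), p (r • x) = r • p x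

/-! Multiplication by a nonzero integer is bijective on `Y` and `Z`, hence on `X`, so `X` is a
rational vector space; the difficulty is topological. The core estimate,
`exists_nhds_inv_pow_smul_mem`, lifts p(D⁻ᵐx), for x in `U`, to wₘ, small for large m. The errors yₘ
= D⁻ᵐx - wₘ lie in `Y` and satisfy D yₘ₊₁ = yₘ + gₘ with gₘ = wₘ - D wₘ₊₁ eventually small; `D` is
chosen so that this recursion contracts, and D⁻ᵐx tends to 0 uniformly on `U`. Division with
remainder passes from powers of `D` to all small rationals (`exists_rat_smul_mem_of_inv_pow`). So q
↦ q x is continuous, and completeness of `Y` together with the scalar action on `Z` extends it to ℝ.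
Uniqueness of the extensions gives the module axioms, and density of ℚ carries the uniform estimate
to real scalars. -/

/-- An abelian group on which every nonzero natural number acts bijectively is a rational vector
space. -/
theorem nonempty_module_rat {X : Type*} [AddCommGroup X]
    (h : ∀ n : ℕ, n ≠ 0 → Function.Bijective fun x : X => n • x) : Nonempty (Module ℚ X) := by
  have hb : ∀ x : ℤ, x ≠ 0 → Function.Bijective fun y : X => x • y := by
    intro x hx
    have hb := h _ (Int.natAbs_ne_zero.mpr hx)
    rcases Int.natAbs_eq x with hx' | hx'
    · convert hb using 1
      ext y
      rw [← natCast_zsmul, ← hx']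
    · convert (Equiv.neg X).bijective.comp hb using 1
      ext y
      rw [Function.comp_apply, Equiv.neg_apply, ← natCast_zsmul, ← neg_smul, ← hx']
  -- `X` is its own localization at the nonzero integers, so the fraction field ℚ acts on it.
  have : IsLocalizedModule (nonZeroDivisors ℤ) (LinearMap.id : X →ₗ[ℤ] X) :=
    { map_units := fun x => by
        rw [Module.End.isUnit_iff]
        exact hb x (nonZeroDivisors.ne_zero x.2)
      surj := fun y => ⟨(y, 1), by simp⟩
      exists_of_eq := fun h => ⟨1, by simpa using h⟩ }
  let : Module ℚ (LocalizedModule (nonZeroDivisors ℤ) X) :=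
    LocalizedModule.moduleOfIsLocalization
  exact ⟨AddEquiv.module ℚ (AddEquivClass.toAddEquiv
    (IsLocalizedModule.iso (nonZeroDivisors ℤ) (LinearMap.id : X →ₗ[ℤ] X))).symm⟩

/-! ### Locally bounded spaces and a contracting recursion -/

section TVS

variable {E : Type*} [AddCommGroup E] [TopologicalSpace E] [Module ℝ E]

theorem Bornology.IsVonNBounded.exists_forall_inv_pow_smul_mem {B V : Set E}
    (hB : Bornology.IsVonNBounded ℝ B) (hV : V ∈ 𝓝 0) {D : ℝ} (hD : 1 < D) :
    ∃ N : ℕ, ∀ n ≥ N, ∀ b ∈ B, (D ^ n)⁻¹ • b ∈ V := by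
  have h := (hB hV).eventually_nhds_zero (mem_of_mem_nhds hV)
  have ht : Filter.Tendsto (fun n : ℕ => (D ^ n)⁻¹) Filter.atTop (𝓝 0) :=
    (tendsto_pow_atTop_atTop_of_one_lt hD).inv_tendsto_atTop
  obtain ⟨N, hN⟩ := Filter.eventually_atTop.mp (ht.eventually h)
  exact ⟨N, fun n hn b hb => hN n hn hb⟩

/-- A locally bounded space has a bounded balanced neighbourhood `B` of zero with
`D⁻¹ (B + B) ⊆ 2⁻¹ B` for some integer `D`. -/
theorem IsLocallyBoundedTVS.exists_balanced [IsTopologicalAddGroup E] [ContinuousSMul ℝ E]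
    (hE : IsLocallyBoundedTVS E) :
    ∃ B ∈ 𝓝 (0 : E), Bornology.IsVonNBounded ℝ B ∧ Balanced ℝ B ∧
      ∃ D : ℕ, 2 ≤ D ∧ ∀ a ∈ B, ∀ b ∈ B, (2 : ℝ) • (D : ℝ)⁻¹ • (a + b) ∈ B := by
  obtain ⟨B', hB', hbd'⟩ := hE
  have hB : balancedCore ℝ B' ∈ 𝓝 (0 : E) := balancedCore_mem_nhds_zero hB'
  have hbd := hbd'.subset (balancedCore_subset (𝕜 := ℝ) B')
  refine ⟨balancedCore ℝ B', hB, hbd, balancedCore_balanced _, ?_⟩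
  have hc : Filter.Tendsto (fun x : E × E => (2 : ℝ) • (x.1 + x.2)) (𝓝 (0, 0)) (𝓝 0) := by
    have : Continuous fun x : E × E => (2 : ℝ) • (x.1 + x.2) := by fun_prop
    simpa using this.tendsto (0, 0)
  have h0 := hc hB
  rw [Filter.mem_map, nhds_prod_eq, Filter.mem_prod_same_iff] at h0
  obtain ⟨V, hV, hVB⟩ := h0
  obtain ⟨N, hN⟩ := hbd.exists_forall_inv_pow_smul_mem hV (D := 2) (by norm_num)
  -- The exponent `N` would already give the inclusion; one more ensures 2 ≤ D.
  refine ⟨2 ^ (N + 1), by rw [pow_succ]; have := Nat.one_le_two_pow (n := N); omega, ?_⟩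
  intro a ha b hb
  have := hVB (Set.mk_mem_prod (hN (N + 1) (by omega) a ha) (hN (N + 1) (by omega) b hb))
  simpa [smul_add] using this

-- Since yₙ₊₁ = D⁻¹(yₙ + gₙ), each step gains a factor 2 as long as gₙ is equally small; k steps
-- after the gₙ enter 2⁻ᵏB, so do the yₙ.
omit [TopologicalSpace E] in
theorem two_pow_smul_mem_of_recursion {B : Set E} (hB : Balanced ℝ B) {D : ℝ} (hD : D ≠ 0)
    (h2 : ∀ a ∈ B, ∀ b ∈ B, (2 : ℝ) • D⁻¹ • (a + b) ∈ B) {y g : ℕ → E} (hy : y 0 ∈ B)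
    (hrec : ∀ n, D • y (n + 1) = y n + g n) (hg : ∀ n, g n ∈ B) {N k : ℕ}
    (hgk : ∀ n ≥ N, (2 : ℝ) ^ k • g n ∈ B) :
    ∀ n ≥ N + k, (2 : ℝ) ^ k • y n ∈ B := by
  have hmono : ∀ {s t : ℝ} {x : E}, 0 ≤ s → s ≤ t → t • x ∈ B → s • x ∈ B := by
    intro s t x hs hst hx
    rcases hs.eq_or_lt with rfl | hs'
    · rw [zero_smul]
      exact hB.zero_mem ⟨_, hx⟩
    · have ht : 0 < t := hs'.trans_le hst
      have : (s / t) • t • x ∈ B := hB.smul_mem (by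
        rw [Real.norm_of_nonneg (by positivity)]
        exact (div_le_one ht).mpr hst) hx
      rwa [smul_smul, div_mul_cancel₀ _ ht.ne'] at this
  have hstep : ∀ (j n : ℕ), (2 : ℝ) ^ j • y n ∈ B → (2 : ℝ) ^ j • g n ∈ B →
      (2 : ℝ) ^ (j + 1) • y (n + 1) ∈ B := by
    intro j n h1 h2'
    have := h2 _ h1 _ h2'
    rwa [← smul_add, ← hrec, smul_comm D⁻¹, inv_smul_smul₀ hD, smul_smul, ← pow_succ'] at this
  have h0 : ∀ n, y n ∈ B := by
    intro n
    induction n with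
    | zero => exact hy
    | succ n ih =>
      have := hstep 0 n (by simpa using ih) (by simpa using hg n)
      simpa using hmono (s := 1) (by norm_num) (by norm_num) this
  have : ∀ j ≤ k, ∀ n ≥ N + j, (2 : ℝ) ^ j • y n ∈ B := by
    intro j
    induction j with
    | zero => intro _ n _; simpa using h0 n
    | succ j ih =>
      intro hj n hn
      obtain ⟨m, rfl⟩ : ∃ m, n = m + 1 := ⟨n - 1, by omega⟩
      exact hstep j m (ih (by omega) m (by omega))
        (hmono (by positivity) (pow_le_pow_right₀ (by norm_num) (by omega)) (hgk m (by omega)))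
  exact this k le_rfl

end TVS

/-! ### Extensions and contraction by powers of an integer -/

namespace IsTopAddGroupExtension

variable {Y X Z : Type*}
  [AddCommGroup Y] [TopologicalSpace Y] [IsTopologicalAddGroup Y]
  [AddCommGroup X] [TopologicalSpace X] [IsTopologicalAddGroup X]
  [AddCommGroup Z] [TopologicalSpace Z] [IsTopologicalAddGroup Z]
  {i : Y →+ X} {p : X →+ Z}

theorem isInducing_left (hE : IsTopAddGroupExtension i p) : IsInducing i := by
  have h : IsInducing (Set.rangeFactorization i) :=
    (IsOpenEmbedding.of_continuous_injective_isOpenMap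
      (hE.continuous_left.subtype_mk _)
      (fun a b h => hE.injective (congrArg Subtype.val h)) hE.open_left).isInducing
  exact IsInducing.subtypeVal.comp h

theorem isOpenMap_right (hE : IsTopAddGroupExtension i p) : IsOpenMap p := by
  have h : IsOpen (Set.range p) := by
    rw [hE.surjective.range_eq]; exact isOpen_univ
  exact h.isOpenMap_subtype_val.comp hE.open_right

theorem right_left (hE : IsTopAddGroupExtension i p) (y : Y) : p (i y) = 0 := by
  have : i y ∈ p.ker := hE.exact ▸ ⟨y, rfl⟩
  exact this

theorem exists_left_eq (hE : IsTopAddGroupExtension i p) {x : X} (hx : p x = 0) :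
    ∃ y, i y = x := by
  have : x ∈ i.range := hE.exact ▸ hx
  exact this

theorem exists_left_eq_sub (hE : IsTopAddGroupExtension i p) {x w : X} (h : p x = p w) :
    ∃ y, i y = x - w :=
  hE.exists_left_eq (by rw [map_sub, h, sub_self])

theorem image_right_mem_nhds (hE : IsTopAddGroupExtension i p) {V : Set X} (hV : V ∈ 𝓝 0) :
    p '' V ∈ 𝓝 0 := by
  simpa using hE.isOpenMap_right.image_mem_nhds hV

theorem exists_nhds_left (hE : IsTopAddGroupExtension i p) {B : Set Y} (hB : B ∈ 𝓝 0) :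
    ∃ O ∈ 𝓝 (0 : X), ∀ y, i y ∈ O → y ∈ B := by
  rw [hE.isInducing_left.nhds_eq_comap, map_zero] at hB
  exact hB

theorem nonempty_module_rat [Module ℝ Y] [Module ℝ Z] (hE : IsTopAddGroupExtension i p) :
    Nonempty (Module ℚ X) := by
  refine _root_.nonempty_module_rat fun n hn => ⟨?_, ?_⟩
  · refine (injective_iff_map_eq_zero (nsmulAddMonoidHom n : X →+ X)).mpr fun x hx => ?_
    replace hx : n • x = 0 := hx
    have hpx : (n : ℝ) • p x = 0 := by
      rw [Nat.cast_smul_eq_nsmul, ← map_nsmul, hx, map_zero]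
    obtain ⟨y, rfl⟩ := hE.exists_left_eq ((smul_eq_zero_iff_right (by exact_mod_cast hn)).mp hpx)
    have hy : (n : ℝ) • y = 0 := by
      rw [Nat.cast_smul_eq_nsmul]
      exact hE.injective (by rw [map_nsmul, hx, map_zero])
    rw [(smul_eq_zero_iff_right (by exact_mod_cast hn)).mp hy, map_zero]
  · intro x
    have hn' : (n : ℝ) ≠ 0 := by exact_mod_cast hn
    obtain ⟨w, hw⟩ := hE.surjective ((n : ℝ)⁻¹ • p x)
    obtain ⟨y, hy⟩ := hE.exists_left_eq_sub (x := x) (w := n • w) (by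
      rw [map_nsmul, hw, ← Nat.cast_smul_eq_nsmul ℝ, smul_inv_smul₀ hn'])
    refine ⟨w + i ((n : ℝ)⁻¹ • y), ?_⟩
    change n • (w + i ((n : ℝ)⁻¹ • y)) = x
    rw [smul_add, ← map_nsmul i, ← Nat.cast_smul_eq_nsmul ℝ n (_ • y), smul_inv_smul₀ hn', hy]
    abel

/-- There is a neighbourhood `U` of zero in the middle group such that the contractions of `U` by
powers of a fixed integer form a basis of neighbourhoods of zero. -/
theorem exists_nhds_inv_pow_smul_mem [Module ℝ Y] [ContinuousSMul ℝ Y] [Module ℝ Z]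
    [ContinuousSMul ℝ Z] [Module ℚ X] (hE : IsTopAddGroupExtension i p)
    (hY : IsLocallyBoundedTVS Y) (hZ : IsLocallyBoundedTVS Z) :
    ∃ U ∈ 𝓝 (0 : X), ∃ D : ℕ, 2 ≤ D ∧ (∀ x, ∃ n : ℕ, ((D : ℚ) ^ n)⁻¹ • x ∈ U) ∧
      ∀ V ∈ 𝓝 (0 : X), ∃ N : ℕ, ∀ n ≥ N, ∀ x ∈ U, ((D : ℚ) ^ n)⁻¹ • x ∈ V := by
  obtain ⟨B, hB, hBbd, hBbal, D, hD2, hBD⟩ := hY.exists_balanced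
  obtain ⟨A, hA, hAbd⟩ := hZ
  have hD1 : (1 : ℝ) < D := by exact_mod_cast hD2
  have hD0 : (D : ℝ) ≠ 0 := by positivity
  have hDq : (D : ℚ) ≠ 0 := by positivity
  have hp : ∀ (n : ℕ) (x : X), p (((D : ℚ) ^ n)⁻¹ • x) = ((D : ℝ) ^ n)⁻¹ • p x := by
    intro n x
    simpa using map_ratCast_smul p ℚ ℝ (((D : ℚ) ^ n)⁻¹) x
  have hi : ∀ (n : ℕ) (y : Y), i (((D : ℝ) ^ n)⁻¹ • y) = ((D : ℚ) ^ n)⁻¹ • i y := by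
    intro n x
    simpa using map_inv_natCast_smul i ℝ ℚ (D ^ n) x
  have hc : ∀ O ∈ 𝓝 (0 : X), ∃ W ∈ 𝓝 (0 : X), ∀ a ∈ W, ∀ b ∈ W, a - D • b ∈ O := by
    intro O hO
    have hc : Filter.Tendsto (fun x : X × X => x.1 - D • x.2) (𝓝 (0, 0)) (𝓝 0) := by
      have : Continuous fun x : X × X => x.1 - D • x.2 := by fun_prop
      simpa using this.tendsto (0, 0)
    have h0 := hc hO
    rw [Filter.mem_map, nhds_prod_eq, Filter.mem_prod_same_iff] at h0
    obtain ⟨V, hV, hVB⟩ := h0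
    exact ⟨V, hV, fun a ha b hb => hVB (Set.mk_mem_prod ha hb)⟩
  obtain ⟨O, hO, hOB⟩ := hE.exists_nhds_left hB
  obtain ⟨W, hW, hWO⟩ := hc O hO
  -- Points of `C` lift into `W`; balancedness keeps contractions in `C`, and `A` makes `C` bounded.
  set C := balancedCore ℝ (p '' W ∩ A) with hC
  have hCn : C ∈ 𝓝 (0 : Z) :=
    balancedCore_mem_nhds_zero (Filter.inter_mem (hE.image_right_mem_nhds hW) hA)
  have hCsub : C ⊆ p '' W ∩ A := balancedCore_subset _
  have hCbal : Balanced ℝ C := balancedCore_balanced _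
  have hCbd : Bornology.IsVonNBounded ℝ C := hAbd.subset (hCsub.trans Set.inter_subset_right)
  set U := W ∩ p ⁻¹' C with hUdef
  have hU : U ∈ 𝓝 (0 : X) := Filter.inter_mem hW
    (hE.continuous_right.continuousAt.preimage_mem_nhds (by simpa using hCn))
  have hlift : ∀ (n : ℕ), ∀ x ∈ U, ∃ w ∈ U, p w = p (((D : ℚ) ^ n)⁻¹ • x) := by
    intro n x hx
    have : p (((D : ℚ) ^ n)⁻¹ • x) ∈ C := by
      rw [hp]
      refine hCbal.smul_mem ?_ hx.2
      rw [norm_inv, norm_pow, Real.norm_natCast]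
      exact inv_le_one_of_one_le₀ (one_le_pow₀ hD1.le)
    obtain ⟨w, hw, hpw⟩ := (hCsub this).1
    exact ⟨w, ⟨hw, by rw [Set.mem_preimage, hpw]; exact this⟩, hpw⟩
  have hdecay : ∀ V ∈ 𝓝 (0 : X), ∃ N : ℕ, ∀ n ≥ N, ∀ x ∈ U, ((D : ℚ) ^ n)⁻¹ • x ∈ V := by
    intro V hV
    obtain ⟨V₁, hV₁, hVV⟩ := exists_nhds_zero_half hV
    have hiV : i ⁻¹' V₁ ∈ 𝓝 (0 : Y) :=
      hE.continuous_left.continuousAt.preimage_mem_nhds (by simpa using hV₁)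
    obtain ⟨k, hk⟩ := hBbd.exists_forall_inv_pow_smul_mem hiV (D := 2) (by norm_num)
    have hB' : (fun y : Y => (2 : ℝ) ^ k • y) ⁻¹' B ∈ 𝓝 (0 : Y) :=
      (continuous_const_smul ((2 : ℝ) ^ k)).continuousAt.preimage_mem_nhds (by simpa using hB)
    obtain ⟨O', hO', hOB'⟩ := hE.exists_nhds_left hB'
    obtain ⟨W', hW', hWO'⟩ := hc O' hO'
    obtain ⟨N, hN⟩ := hCbd.exists_forall_inv_pow_smul_mem
      (hE.image_right_mem_nhds (Filter.inter_mem (Filter.inter_mem hW' hV₁) hU)) hD1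
    -- Starting at N + 1 keeps m = 0 out of the range of small lifts, so that w₀ = x and y₀ = 0 are
    -- possible.
    refine ⟨N + 1 + k, fun n hn x hx => ?_⟩
    have hw : ∀ m : ℕ, ∃ w ∈ U, p w = p (((D : ℚ) ^ m)⁻¹ • x) ∧ (m = 0 → w = x) ∧
        (N + 1 ≤ m → w ∈ W' ∧ w ∈ V₁) := by
      intro m
      by_cases hm : N + 1 ≤ m
      · obtain ⟨w, ⟨⟨hw1, hw2⟩, hw3⟩, hpw⟩ := hN m (by omega) _ hx.2
        exact ⟨w, hw3, by rw [hpw, hp], by omega, fun _ => ⟨hw1, hw2⟩⟩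
      · rcases Nat.eq_zero_or_pos m with rfl | hm0
        · exact ⟨x, hx, by simp, fun _ => rfl, fun h => absurd h hm⟩
        · obtain ⟨w, hw, hpw⟩ := hlift m x hx
          exact ⟨w, hw, hpw, by omega, fun h => absurd h hm⟩
    choose w hwU hpw hw0 hwN using hw
    choose y hy using fun m => hE.exists_left_eq_sub (hpw m).symm
    have hg : ∀ m, i (D • y (m + 1) - y m) = w m - D • w (m + 1) := by
      intro m
      have : D • ((D : ℚ) ^ (m + 1))⁻¹ • x = ((D : ℚ) ^ m)⁻¹ • x := by
        rw [← Nat.cast_smul_eq_nsmul ℚ, smul_smul, pow_succ']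
        congr 1
        field_simp
      rw [map_sub, map_nsmul, hy, hy, smul_sub, this]
      abel
    have hyk := two_pow_smul_mem_of_recursion (D := D) (y := y)
      (g := fun m => D • y (m + 1) - y m) (N := N + 1) (k := k) hBbal hD0 hBD
      (by
        have : y 0 = 0 := hE.injective (by rw [hy, hw0 0 rfl]; simp)
        rw [this]
        exact mem_of_mem_nhds hB)
      (fun m => by rw [Nat.cast_smul_eq_nsmul]; abel)
      (fun m => hOB _ (by rw [hg]; exact hWO _ (hwU m).1 _ (hwU (m + 1)).1))
      (fun m hm => hOB' _ (by
        rw [hg]; exact hWO' _ (hwN m hm).1 _ (hwN (m + 1) (by omega)).1)) n hn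
    have h1 := hk k le_rfl _ hyk
    rw [inv_smul_smul₀ (by positivity), Set.mem_preimage, hy] at h1
    have := hVV _ (hwN n (by omega)).2 _ h1
    rwa [add_sub_cancel] at this
  refine ⟨U, hU, D, hD2, fun x => ?_, hdecay⟩
  -- Write D⁻ᵏx = u + i(y) with u in `U`; further contraction makes both terms small.
  obtain ⟨k, hk⟩ := (Bornology.isVonNBounded_singleton (𝕜 := ℝ) (p x)).exists_forall_inv_pow_smul_mem
    (hE.image_right_mem_nhds hU) hD1
  obtain ⟨u, hu, hpu⟩ := hk k le_rfl _ rfl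
  rw [← hp] at hpu
  obtain ⟨y, hy⟩ := hE.exists_left_eq_sub hpu.symm
  obtain ⟨V₁, hV₁, hVV⟩ := exists_nhds_zero_half hU
  obtain ⟨m, hm⟩ := hdecay V₁ hV₁
  have hiV : i ⁻¹' V₁ ∈ 𝓝 (0 : Y) :=
    hE.continuous_left.continuousAt.preimage_mem_nhds (by simpa using hV₁)
  obtain ⟨l, hl⟩ :=
    (Bornology.isVonNBounded_singleton (𝕜 := ℝ) y).exists_forall_inv_pow_smul_mem hiV hD1
  refine ⟨m + l + k, ?_⟩
  have := hVV _ (hm (m + l) (by omega) u hu) _ (hl (m + l) (by omega) y rfl)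
  rw [hi, hy, ← smul_add, add_sub_cancel, smul_smul, ← mul_inv, ← pow_add] at this
  exact this

end IsTopAddGroupExtension

/-! ### Uniform smallness for rational scalars -/

theorem exists_rat_smul_mem_of_inv_pow {X : Type*} [AddCommGroup X] [TopologicalSpace X]
    [IsTopologicalAddGroup X] [Module ℚ X] {U : Set X} (hU : U ∈ 𝓝 0) {D : ℕ} (hD : 2 ≤ D)
    (habs : ∀ x, ∃ n : ℕ, ((D : ℚ) ^ n)⁻¹ • x ∈ U)
    (hdecay : ∀ V ∈ 𝓝 (0 : X), ∃ N : ℕ, ∀ n ≥ N, ∀ x ∈ U, ((D : ℚ) ^ n)⁻¹ • x ∈ V)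
    {V : Set X} (hV : V ∈ 𝓝 0) :
    ∃ δ : ℚ, 0 < δ ∧ ∀ q : ℚ, |q| ≤ δ → ∀ x ∈ U, q • x ∈ V := by
  have hDq : (D : ℚ) ≠ 0 := by positivity
  have habs' : ∀ x, ∃ N : ℕ, ∀ n ≥ N, ((D : ℚ) ^ n)⁻¹ • x ∈ U := by
    intro x
    obtain ⟨k, hk⟩ := habs x
    obtain ⟨N, hN⟩ := hdecay U hU
    refine ⟨N + k, fun n hn => ?_⟩
    have := hN (n - k) (by omega) _ hk
    rwa [smul_smul, ← mul_inv, ← pow_add, Nat.sub_add_cancel (by omega)] at this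
  -- a power `E` of `D` with `D E⁻¹ (U + U) ⊆ U`
  obtain ⟨k, hk⟩ : ∃ k : ℕ, ∀ a ∈ U, ∀ b ∈ U, (D : ℚ) • ((D : ℚ) ^ k)⁻¹ • (a + b) ∈ U := by
    have hc : Filter.Tendsto (fun x : X × X => D • (x.1 + x.2)) (𝓝 (0, 0)) (𝓝 0) := by
      have : Continuous fun x : X × X => D • (x.1 + x.2) := by fun_prop
      simpa using this.tendsto (0, 0)
    have h0 := hc hU
    rw [Filter.mem_map, nhds_prod_eq, Filter.mem_prod_same_iff] at h0
    obtain ⟨W, hW, hWU⟩ := h0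
    obtain ⟨k, hk⟩ := hdecay W hW
    refine ⟨k, fun a ha b hb => ?_⟩
    have := hWU (Set.mk_mem_prod (hk k le_rfl a ha) (hk k le_rfl b hb))
    rwa [Set.mem_preimage, ← smul_add, ← Nat.cast_smul_eq_nsmul ℚ] at this
  obtain ⟨c, hc⟩ : ∃ c : ℕ, ∀ n ≥ c, ∀ x ∈ U, ∀ d : ℤ, |d| ≤ (D : ℤ) ^ k →
      ((D : ℚ) ^ n)⁻¹ • (d : ℚ) • x ∈ U := by
    have : (⋂ d ∈ Set.Icc (-(D : ℤ) ^ k) ((D : ℤ) ^ k), (fun x : X => d • x) ⁻¹' U) ∈ 𝓝 0 := by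
      refine (Filter.biInter_mem (Set.finite_Icc _ _)).mpr fun d _ => ?_
      exact (continuous_zsmul d).continuousAt.preimage_mem_nhds (by simpa using hU)
    obtain ⟨c, hc⟩ := hdecay _ this
    refine ⟨c, fun n hn x hx d hd => ?_⟩
    have := Set.mem_iInter₂.mp (hc n hn x hx) d (abs_le.mp hd)
    rwa [Set.mem_preimage, ← Int.cast_smul_eq_zsmul ℚ, smul_comm] at this
  -- The exponent `c` must not depend on the denominator `b`. For fixed `b` and `x` there are
  -- finitely many `a`, so some larger exponent c + n works; it is then lowered one at a time.
  have hunit : ∀ x ∈ U, ∀ b : ℤ, 0 < b → ∀ a : ℤ, |a| ≤ b →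
      ((D : ℚ) ^ c)⁻¹ • ((a : ℚ) / b) • x ∈ U := by
    intro x hx b hb
    have hbq : (b : ℚ) ≠ 0 := by exact_mod_cast hb.ne'
    have hstart : ∃ n : ℕ, ∀ a : ℤ, |a| ≤ b → ((D : ℚ) ^ (c + n))⁻¹ • ((a : ℚ) / b) • x ∈ U := by
      choose N hN using fun a : ℤ => habs' (((a : ℚ) / b) • x)
      refine ⟨(Finset.Icc (-b) b).sup N, fun a ha => hN a _ ?_⟩
      exact (Finset.le_sup (f := N) (Finset.mem_Icc.mpr (abs_le.mp ha))).trans (by omega)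
    obtain ⟨n, hn⟩ := hstart
    induction n with
    | zero => exact hn
    | succ n ih =>
      refine ih fun a ha => ?_
      set E : ℤ := (D : ℤ) ^ k with hE
      have hE0 : 0 < E := by positivity
      obtain ⟨ha1, ha2⟩ := abs_le.mp ha
      have hd : |E * a / b| ≤ E := by
        rw [abs_le]
        constructor
        · rw [Int.le_ediv_iff_mul_le hb]
          nlinarith
        · exact Int.ediv_le_of_le_mul hb (by nlinarith)
      have hr : |E * a % b| ≤ b := by
        rw [abs_of_nonneg (Int.emod_nonneg _ hb.ne')]
        exact (Int.emod_lt_of_pos _ hb).le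
      -- With E a = b d + r, one has a/b = E⁻¹(d + r/b); the factor `D` in `hk` turns exponent c + n
      -- + 1 into c + n.
      have h1 := hk _ (hc (c + (n + 1)) (by omega) x hx _ hd) _ (hn _ hr)
      have heq : (E : ℚ) * a = b * ((E * a / b : ℤ) : ℚ) + ((E * a % b : ℤ) : ℚ) := by
        exact_mod_cast (Int.mul_ediv_add_emod (E * a) b).symm
      have hEq : (E : ℚ) = (D : ℚ) ^ k := by rw [hE]; push_cast; rfl
      rw [← smul_add, ← add_smul, smul_smul, smul_smul, smul_smul] at h1
      rw [smul_smul]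
      convert h1 using 2
      have : ((E * a / b : ℤ) : ℚ) + ((E * a % b : ℤ) : ℚ) / b = (D : ℚ) ^ k * a / b := by
        rw [← hEq, heq]
        field_simp
      rw [this, ← add_assoc, pow_succ]
      field_simp
  obtain ⟨N, hN⟩ := hdecay V hV
  refine ⟨((D : ℚ) ^ (N + c))⁻¹, by positivity, fun q hq x hx => ?_⟩
  set r := q * (D : ℚ) ^ (N + c) with hr
  have hr1 : |r| ≤ 1 := by
    rw [hr, abs_mul, abs_of_pos (by positivity : (0 : ℚ) < (D : ℚ) ^ (N + c))]
    calc |q| * (D : ℚ) ^ (N + c) ≤ ((D : ℚ) ^ (N + c))⁻¹ * (D : ℚ) ^ (N + c) := by gcongr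
      _ = 1 := inv_mul_cancel₀ (by positivity)
  have hden : (0 : ℤ) < r.den := by exact_mod_cast r.den_pos
  have hnum : |r.num| ≤ (r.den : ℤ) := by
    have h2 : |(r.num : ℚ)| / r.den ≤ 1 := by
      rwa [← Nat.abs_cast r.den, ← abs_div, Rat.num_div_den]
    rw [div_le_one (by exact_mod_cast r.den_pos)] at h2
    exact_mod_cast h2
  have := hN N le_rfl _ (hunit x hx _ hden _ hnum)
  rw [Int.cast_natCast, Rat.num_div_den, smul_smul, smul_smul, hr] at this
  convert this using 2
  rw [pow_add]
  field_simp

/-! ### Completeness and real one-parameter subgroups -/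

namespace IsTopAddGroupExtension

/-- If the kernel is complete, a Cauchy filter in the middle group converges as soon as its image
in the quotient does. -/
theorem exists_le_nhds_of_cauchy {Y X Z : Type*}
    [AddCommGroup Y] [UniformSpace Y] [IsUniformAddGroup Y] [CompleteSpace Y]
    [AddCommGroup X] [UniformSpace X] [IsUniformAddGroup X]
    [AddCommGroup Z] [TopologicalSpace Z] [IsTopologicalAddGroup Z]
    {i : Y →+ X} {p : X →+ Z} (hE : IsTopAddGroupExtension i p) {F : Filter X} (hF : Cauchy F)
    {w : X} (hp : Filter.Tendsto p F (𝓝 (p w))) : ∃ c, F ≤ 𝓝 c := by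
  have := hF.1
  -- Translates of `F` by -w need not meet the image of `i`; subtracting arbitrarily small elements
  -- ensures that they do.
  set u : X × X → X := fun x => x.1 - w - x.2 with hu
  have hH : Cauchy (Filter.map u (F ×ˢ 𝓝 0)) :=
    (hF.prod cauchy_nhds).map ((uniformContinuous_fst.sub uniformContinuous_const).sub
      uniformContinuous_snd)
  have hne : (Filter.comap i (Filter.map u (F ×ˢ 𝓝 0))).NeBot := by
    rw [Filter.comap_neBot_iff]
    intro S hS
    obtain ⟨A, hA, V, hV, hAV⟩ := Filter.mem_prod_iff.mp (Filter.mem_map.mp hS)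
    have hsub : Filter.Tendsto (fun a => p a - p w) F (𝓝 0) := by
      simpa using hp.sub_const (p w)
    obtain ⟨a, ha, v, hv, hva⟩ :=
      this.nonempty_of_mem (Filter.inter_mem hA (hsub (hE.image_right_mem_nhds hV)))
    obtain ⟨y, hy⟩ := hE.exists_left_eq (x := a - w - v) (by simp [hva])
    exact ⟨y, by rw [hy]; exact hAV (Set.mk_mem_prod ha hv)⟩
  have hui : IsUniformInducing i := AddMonoidHom.isUniformInducing_of_isInducing hE.isInducing_left
  obtain ⟨y, hy⟩ := CompleteSpace.complete (hH.comap' hui.comap_uniformity.le hne)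
  have hlim : Filter.map u (F ×ˢ 𝓝 0) ≤ 𝓝 (i y) := by
    refine le_nhds_of_cauchy_adhp hH ?_
    have h1 : Filter.map i (Filter.comap i (Filter.map u (F ×ˢ 𝓝 0))) ≤
        𝓝 (i y) ⊓ Filter.map u (F ×ˢ 𝓝 0) :=
      le_inf ((Filter.map_mono hy).trans (hE.continuous_left.tendsto y)) Filter.map_comap_le
    exact (hne.map i).mono h1
  have hfst : Filter.Tendsto (Prod.fst : X × X → X) (F ×ˢ 𝓝 0) (𝓝 (i y + w + 0)) := by
    have h2 : Filter.Tendsto (fun x => u x + w + x.2) (F ×ˢ 𝓝 0) (𝓝 (i y + w + 0)) :=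
      (Filter.Tendsto.add_const w hlim).add Filter.tendsto_snd
    refine h2.congr fun x => ?_
    simp only [hu]
    abel
  rw [Filter.Tendsto, Filter.map_fst_prod] at hfst
  exact ⟨_, hfst⟩

/-- A continuous rational one-parameter subgroup of the middle group extends to a real one. -/
theorem exists_real_addMonoidHom {Y X Z : Type*}
    [AddCommGroup Y] [UniformSpace Y] [IsUniformAddGroup Y] [CompleteSpace Y]
    [AddCommGroup X] [TopologicalSpace X] [IsTopologicalAddGroup X] [T2Space X] [Module ℚ X]
    [AddCommGroup Z] [TopologicalSpace Z] [IsTopologicalAddGroup Z] [Module ℝ Z]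
    [ContinuousSMul ℝ Z]
    {i : Y →+ X} {p : X →+ Z} (hE : IsTopAddGroupExtension i p) (x : X)
    (hx : Filter.Tendsto (fun q : ℚ => q • x) (𝓝 0) (𝓝 0)) :
    ∃ f : ℝ →+ X, Continuous f ∧ ∀ q : ℚ, f q = q • x := by
  let := IsTopologicalAddGroup.rightUniformSpace X
  have : IsUniformAddGroup X := isUniformAddGroup_of_addCommGroup
  let φ : ℚ →+ X := (AddMonoidHom.smul : ℚ →+ X →+ X).flip x
  have hφ : Continuous φ := continuous_of_continuousAt_zero φ (by
    rw [ContinuousAt, map_zero]; exact hx)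
  have hφu : UniformContinuous φ := uniformContinuous_addMonoidHom_of_continuous hφ
  have di := Rat.isDenseEmbedding_coe_real.isDenseInducing
  have hlim : ∀ r : ℝ, ∃ c, Filter.Tendsto φ (Filter.comap ((↑) : ℚ → ℝ) (𝓝 r)) (𝓝 c) := by
    intro r
    obtain ⟨w, hw⟩ := hE.surjective (r • p x)
    have hC : Cauchy (Filter.comap ((↑) : ℚ → ℝ) (𝓝 r)) :=
      cauchy_nhds.comap' Rat.isUniformEmbedding_coe_real.comap_uniformity.le (di.comap_nhds_neBot r)
    refine hE.exists_le_nhds_of_cauchy (w := w) (hC.map hφu) ?_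
    rw [Filter.tendsto_map'_iff, hw]
    have h1 : Filter.Tendsto (fun q : ℚ => (q : ℝ) • p x) (Filter.comap ((↑) : ℚ → ℝ) (𝓝 r))
        (𝓝 (r • p x)) := Filter.tendsto_comap.smul_const _
    exact h1.congr fun q => (map_ratCast_smul p ℚ ℝ q x).symm
  have hcont : Continuous (di.extend φ) := di.continuous_extend hlim
  have hq : ∀ q : ℚ, di.extend φ (q : ℝ) = φ q := fun q => di.extend_eq hφ q
  refine ⟨AddMonoidHom.mk' (di.extend φ) fun a b => ?_, hcont, hq⟩
  refine Rat.isDenseEmbedding_coe_real.dense.induction_on₂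
    (p := fun a b => di.extend φ (a + b) = di.extend φ a + di.extend φ b) ?_ (fun s t => ?_) a b
  · exact isClosed_eq (by fun_prop) (by fun_prop)
  · rw [← Rat.cast_add, hq, hq, hq, map_add]

end IsTopAddGroupExtension

/-! ### Real scalar multiplication and its continuity -/

section RealModule

variable {X : Type*} [AddCommGroup X] [TopologicalSpace X] [T2Space X] [Module ℚ X]

theorem AddMonoidHom.eq_of_continuous_of_map_one {f g : ℝ →+ X} (hf : Continuous f)
    (hg : Continuous g) (h : f 1 = g 1) : f = g := by
  refine DFunLike.coe_injective (Rat.isDenseEmbedding_coe_real.dense.equalizer hf hg ?_)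
  ext q
  have key : ∀ k : ℝ →+ X, k (q : ℝ) = q • k 1 := fun k => by
    simpa using map_ratCast_smul k ℝ ℚ q (1 : ℝ)
  simp [key, h]

/-- A Hausdorff topological group in which every element lies on a continuous one-parameter
subgroup is a real vector space. -/
theorem exists_module_real_of_addMonoidHom [IsTopologicalAddGroup X] (f : X → ℝ →+ X)
    (hf : ∀ x, Continuous (f x)) (hf1 : ∀ x, f x 1 = x) :
    ∃ _ : Module ℝ X, ∀ (r : ℝ) (x : X), r • x = f x r := by
  refine ⟨{ smul := fun r x => f x r
            one_smul := hf1
            mul_smul := fun r s x => ?_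
            smul_zero := fun r => ?_
            smul_add := fun r x y => ?_
            add_smul := fun r s x => map_add (f x) r s
            zero_smul := fun x => map_zero (f x) }, fun _ _ => rfl⟩
  · have : f (f x s) = (f x).comp (AddMonoidHom.mulRight s) :=
      AddMonoidHom.eq_of_continuous_of_map_one (hf _)
        ((hf x).comp (continuous_id.mul continuous_const)) (by simp [hf1])
    exact (DFunLike.congr_fun this r).symm
  · have : f 0 = 0 :=
      AddMonoidHom.eq_of_continuous_of_map_one (hf _) continuous_const (by simp [hf1])
    exact DFunLike.congr_fun this r
  · have : f (x + y) = f x + f y :=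
      AddMonoidHom.eq_of_continuous_of_map_one (hf _) ((hf x).add (hf y)) (by simp [hf1])
    exact DFunLike.congr_fun this r

end RealModule

/-- A scalar multiplication which is continuous in the scalar is jointly continuous, with `U`
bounded, if small scalars map `U` uniformly into any neighbourhood of zero. -/
theorem continuousSMul_and_isVonNBounded_of_forall_abs_le {X : Type*} [AddCommGroup X]
    [TopologicalSpace X] [IsTopologicalAddGroup X] [Module ℝ X] {U : Set X} (hU : U ∈ 𝓝 0)
    (hleft : ∀ x : X, Filter.Tendsto (fun r : ℝ => r • x) (𝓝 0) (𝓝 0))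
    (h : ∀ V ∈ 𝓝 (0 : X), ∃ δ : ℝ, 0 < δ ∧ ∀ r : ℝ, |r| ≤ δ → ∀ x ∈ U, r • x ∈ V) :
    ContinuousSMul ℝ X ∧ Bornology.IsVonNBounded ℝ U := by
  constructor
  · refine .of_nhds_zero ?_ hleft fun a => ?_
    · intro V hV
      obtain ⟨δ, hδ, hV'⟩ := h V hV
      rw [Filter.mem_map]
      refine Filter.mem_of_superset (Filter.prod_mem_prod (Metric.closedBall_mem_nhds 0 hδ) hU) ?_
      rintro ⟨r, x⟩ ⟨hr, hx⟩
      exact hV' r (by simpa using hr) x hx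
    · intro V hV
      obtain ⟨δ, hδ, hV'⟩ := h V hV
      -- Write a x = (a/n)(n x): the scalar is at most δ in absolute value, and n x lies in `U` for
      -- x near 0.
      obtain ⟨n, hn⟩ := exists_nat_gt (|a| / δ)
      have hn0 : (0 : ℝ) < n := lt_of_le_of_lt (by positivity) hn
      have : (fun x : X => n • x) ⁻¹' U ∈ 𝓝 0 :=
        (continuous_nsmul n).continuousAt.preimage_mem_nhds (by simpa using hU)
      rw [Filter.mem_map]
      filter_upwards [this] with x hx
      rw [Set.mem_preimage] at hx ⊢
      have := hV' (a / n) (by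
        rw [abs_div, abs_of_pos hn0, div_le_iff₀ hn0, mul_comm]
        exact ((div_lt_iff₀ hδ).mp hn).le) _ hx
      rwa [← Nat.cast_smul_eq_nsmul ℝ, smul_smul, div_mul_cancel₀ _ hn0.ne'] at this
  · intro V hV
    obtain ⟨δ, hδ, hV'⟩ := h V hV
    rw [absorbs_iff_norm]
    refine ⟨δ⁻¹, fun c hc x hx => ?_⟩
    have hc0 : c ≠ 0 := norm_pos_iff.mp ((inv_pos.mpr hδ).trans_le hc)
    refine ⟨c⁻¹ • x, hV' _ ?_ x hx, smul_inv_smul₀ hc0 x⟩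
    rw [abs_inv]
    exact inv_le_of_inv_le₀ hδ hc

theorem theorem5p2 {Y X Z : Type*}
    [AddCommGroup Y] [UniformSpace Y] [IsUniformAddGroup Y] [T2Space Y]
    [Module ℝ Y] [ContinuousSMul ℝ Y] [CompleteSpace Y]
    [AddCommGroup X] [TopologicalSpace X] [IsTopologicalAddGroup X] [T2Space X]
    [AddCommGroup Z] [TopologicalSpace Z] [IsTopologicalAddGroup Z] [T2Space Z]
    [Module ℝ Z] [ContinuousSMul ℝ Z]
    (hY : IsLocallyBoundedTVS Y) (hZ : IsLocallyBoundedTVS Z)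
    (i : Y →+ X) (p : X →+ Z) (hE : IsTopAddGroupExtension i p) :
    ∃ (_ : Module ℝ X) (_ : ContinuousSMul ℝ X),
      IsLocallyBoundedTVS X ∧ IsTVSExtension i p := by
  obtain ⟨_⟩ := hE.nonempty_module_rat
  obtain ⟨U, hU, D, hD, habs, hdecay⟩ := hE.exists_nhds_inv_pow_smul_mem hY hZ
  have hsmall : ∀ V ∈ 𝓝 (0 : X), ∃ δ : ℚ, 0 < δ ∧ ∀ q : ℚ, |q| ≤ δ → ∀ x ∈ U, q • x ∈ V :=
    fun V hV => exists_rat_smul_mem_of_inv_pow hU hD habs hdecay hV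
  have htend : ∀ x : X, Filter.Tendsto (fun q : ℚ => q • x) (𝓝 0) (𝓝 0) := by
    intro x V hV
    obtain ⟨n, hn⟩ := habs x
    obtain ⟨δ, hδ, h⟩ := hsmall V hV
    have hDn : (0 : ℚ) < (D : ℚ) ^ n := by positivity
    have hmul : Filter.Tendsto (fun q : ℚ => |q * (D : ℚ) ^ n|) (𝓝 0) (𝓝 0) := by
      have : Continuous fun q : ℚ => |q * (D : ℚ) ^ n| := by fun_prop
      simpa using this.tendsto 0
    rw [Filter.mem_map]
    filter_upwards [hmul.eventually (ge_mem_nhds hδ)] with q hq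
    rw [Set.mem_preimage]
    have := h _ hq _ hn
    rwa [smul_smul, mul_inv_cancel_right₀ hDn.ne'] at this
  choose f hf hfq using fun x => hE.exists_real_addMonoidHom x (htend x)
  obtain ⟨_, hsmul⟩ := exists_module_real_of_addMonoidHom f hf fun x => by
    simpa using hfq x 1
  have hleft : ∀ x : X, Continuous fun r : ℝ => r • x := fun x => by
    simpa only [hsmul] using hf x
  have hreal : ∀ V ∈ 𝓝 (0 : X), ∃ δ : ℝ, 0 < δ ∧ ∀ r : ℝ, |r| ≤ δ → ∀ x ∈ U, r • x ∈ V := by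
    intro V hV
    obtain ⟨V', hV', hcl, hsub⟩ := exists_mem_nhds_isClosed_subset hV
    obtain ⟨δ, hδ, h⟩ := hsmall V' hV'
    have hδ' : (0 : ℝ) < δ := by exact_mod_cast hδ
    -- Halving puts `r` in the open interval (-δ, δ), where rationals are dense; closedness of `V'`
    -- then passes to the limit.
    refine ⟨δ / 2, by positivity, fun r hr x hx => hsub ?_⟩
    have hmem : r ∈ Set.Ioo (-(δ : ℝ)) δ := by
      obtain ⟨h1, h2⟩ := abs_le.mp hr
      constructor <;> linarith
    have hclos : r ∈ closure (Set.Ioo (-(δ : ℝ)) δ ∩ Set.range ((↑) : ℚ → ℝ)) :=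
      (Rat.denseRange_cast (𝕜 := ℝ)).open_subset_closure_inter isOpen_Ioo hmem
    refine (closure_minimal (t := (fun r : ℝ => r • x) ⁻¹' V') ?_
      (hcl.preimage (hleft x))) hclos
    rintro _ ⟨hq, q, rfl⟩
    rw [Set.mem_preimage, hsmul, hfq]
    exact h q (by exact_mod_cast (abs_lt.mpr hq).le) x hx
  obtain ⟨hcs, hbd⟩ := continuousSMul_and_isVonNBounded_of_forall_abs_le hU
    (fun x => by simpa using (hleft x).tendsto 0) hreal
  exact ⟨_, hcs, ⟨U, hU, hbd⟩, { hE with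
    map_smul_left := map_real_smul i hE.continuous_left
    map_smul_right := map_real_smul p hE.continuous_right }⟩
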